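/- For every prime number $p > 3$ there is a monic irreducible polynomial $T(x) \in \mathbb{Z}[x]$ of degree $p$ whose constant term is $1$ or $-1$ and all of whose complex roots are real and lie in the open interval $(-2.08,\, 2.08)$. -/

import Mathlib

/-!
Let `P = t ^ 3 - t - 1`, with reciprocal `t ^ 3 + t ^ 2 - 1` up to sign. By Salem's construction,
`t ^ m * P ± (t ^ 3 + t ^ 2 - 1)` has for all but small `m`, besides cyclotomic factors, a single
factor, vanishing at a Salem number close to the largest root `θ` of `P`, and `θ + θ⁻¹ < 2.08`.
Divided by their factors `t ± 1` and written in the variable `x = t + t⁻¹`, these polynomials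
satisfy a Chebyshev recursion, and they alternate in sign at the extremal points of a Chebyshev
polynomial, so all their roots are real, at most one exceeds `2` and none exceeds `2.08`. By
Kronecker's theorem such a trace polynomial is irreducible as soon as it does not vanish
at `ζ + ζ⁻¹` for any root of unity `ζ`.

Every root of unity `ζ` has one of `-ζ`, `ζ ^ 2`, `-ζ ^ 2` among its conjugates. Eliminating `ζ ^ m`
between the equations at `ζ` and at this conjugate leaves an equation of bounded degree for `ζ`, and
hence finitely many orders of `ζ`, each of which fixes a residue of `m`. For every odd degree above
`3`, some choice of sign and `m` leaves at most cyclotomic factors of orders `3` and `5`, which are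
divided out.
-/

open Polynomial

/-! ### Polynomials alternating in sign -/

theorem exists_eq_X_sub_C_mul_of_eval_neg {T : ℝ[X]} {a b : ℝ} (hab : a ≤ b)
    (ha : T.eval a < 0) (hb : 0 ≤ T.eval b) :
    ∃ r ∈ Set.Icc a b, ∃ T₁, T = (X - C r) * T₁ ∧ 0 < T₁.eval a := by
  obtain ⟨r, hr, hroot⟩ := intermediate_value_Ioc hab T.continuous.continuousOn ⟨ha, hb⟩
  obtain ⟨T₁, rfl⟩ := dvd_iff_isRoot.2 hroot
  refine ⟨r, Set.Ioc_subset_Icc_self hr, T₁, rfl, ?_⟩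
  simp only [eval_mul, eval_sub, eval_X, eval_C] at ha
  exact pos_of_mul_neg_right ha (sub_neg.2 hr.1).le

theorem exists_eq_X_sub_C_mul_of_eval_nonpos {T : ℝ[X]} {a b : ℝ} (hab : a < b)
    (ha : T.eval a ≤ 0) (hb : 0 ≤ T.eval b) :
    ∃ r ∈ Set.Icc a b, ∃ T₁, T = (X - C r) * T₁ ∧ 0 ≤ T₁.eval a := by
  rcases ha.lt_or_eq with ha | ha
  · obtain ⟨r, hr, T₁, hT, hpos⟩ := exists_eq_X_sub_C_mul_of_eval_neg hab.le ha hb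
    exact ⟨r, hr, T₁, hT, hpos.le⟩
  obtain ⟨T₁, rfl⟩ := dvd_iff_isRoot.2 ha
  rcases le_or_gt 0 (T₁.eval a) with h | h
  · exact ⟨a, Set.left_mem_Icc.2 hab.le, T₁, rfl, h⟩
  simp only [eval_mul, eval_sub, eval_X, eval_C] at hb
  obtain ⟨r, hr, T₂, rfl, -⟩ := exists_eq_X_sub_C_mul_of_eval_neg hab.le h
    (nonneg_of_mul_nonneg_right hb (sub_pos.2 hab))
  exact ⟨r, hr, (X - C a) * T₂, mul_left_comm .., by simp⟩

theorem exists_eq_X_sub_C_mul_of_alternating {T : ℝ[X]} {n : ℕ} {y : ℕ → ℝ} {b : ℝ}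
    (hy : StrictAntiOn y (Set.Iic n)) (hyb : y 0 < b) (hb : 0 ≤ T.eval b)
    (hsgn : ∀ i ≤ n, 0 ≤ (-1) ^ (i + 1) * T.eval (y i)) :
    ∃ r ∈ Set.Icc (y 0) b, ∃ T₁, T = (X - C r) * T₁ ∧
      ∀ i ≤ n, 0 ≤ (-1) ^ i * T₁.eval (y i) := by
  obtain ⟨r, hr, T₁, rfl, h₀⟩ := exists_eq_X_sub_C_mul_of_eval_nonpos hyb
    (by simpa using hsgn 0 n.zero_le) hb
  refine ⟨r, hr, T₁, rfl, fun i hi => ?_⟩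
  rcases i.eq_zero_or_pos with rfl | hpos
  · simpa using h₀
  have hlt : y i < r := (hy (Set.mem_Iic.2 n.zero_le) hi hpos).trans_le hr.1
  refine nonneg_of_mul_nonneg_right ?_ (sub_pos.2 hlt)
  calc 0 ≤ _ := hsgn i hi
    _ = (r - y i) * ((-1) ^ i * T₁.eval (y i)) := by
      simp only [eval_mul, eval_sub, eval_X, eval_C]; ring

theorem splits_and_roots_mem_Icc_of_alternating {n : ℕ} {T : ℝ[X]} {y : ℕ → ℝ}
    (hT : T.Monic) (hdeg : T.natDegree = n) (hy : StrictAntiOn y (Set.Iic n))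
    (hsgn : ∀ i ≤ n, 0 ≤ (-1) ^ i * T.eval (y i)) :
    T.Splits ∧ ∀ r ∈ T.roots, r ∈ Set.Icc (y n) (y 0) := by
  induction n generalizing T y with
  | zero => rw [hT.natDegree_eq_zero.1 hdeg]; simp
  | succ n ih =>
    have hanti : StrictAntiOn (fun i => y (i + 1)) (Set.Iic n) := fun i hi j hj hij =>
      hy (Nat.succ_le_succ hi) (Nat.succ_le_succ hj) (Nat.succ_lt_succ hij)
    have hle : ∀ i ≤ n, y (i + 1) < y 0 := fun i hi =>
      hy (Nat.zero_le (n + 1)) (Nat.succ_le_succ hi) i.succ_pos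
    obtain ⟨r, hr, T₁, rfl, hsgn₁⟩ := exists_eq_X_sub_C_mul_of_alternating hanti
      (hle 0 n.zero_le) (by simpa using hsgn 0 (Nat.zero_le _))
      fun i hi => hsgn (i + 1) (Nat.succ_le_succ hi)
    have hT₁ : T₁.Monic := (monic_X_sub_C r).of_mul_monic_left hT
    rw [(monic_X_sub_C r).natDegree_mul hT₁, natDegree_X_sub_C, add_comm, add_left_inj] at hdeg
    obtain ⟨hsplit, hroots⟩ := ih hT₁ hdeg hanti hsgn₁
    refine ⟨(Splits.X_sub_C r).mul hsplit, fun s hs => ?_⟩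
    rw [roots_mul hT.ne_zero, roots_X_sub_C, Multiset.singleton_add, Multiset.mem_cons] at hs
    rcases hs with rfl | hs
    · exact ⟨(hanti.antitoneOn n.zero_le Set.self_mem_Iic n.zero_le).trans hr.1, hr.2⟩
    · exact ⟨(hroots s hs).1, (hroots s hs).2.trans (hle 0 n.zero_le).le⟩

/-- `T` is a trace polynomial of Salem type, bounded by `c`: a monic integer polynomial all of whose
roots are real and lie in `[-2, c)`, at most one of them, counted with multiplicity, exceeding `2`.
The minimal polynomial of `τ + τ⁻¹`, for a Salem number `τ` with `τ + τ⁻¹ < c`, is of this type. -/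
structure IsSalemTrace (c : ℝ) (T : ℤ[X]) : Prop where
  monic : T.Monic
  splits : (T.map (Int.castRingHom ℝ)).Splits
  roots_mem : ∀ r ∈ (T.map (Int.castRingHom ℝ)).roots, r ∈ Set.Ico (-2) c
  countP_roots_le_one : (T.map (Int.castRingHom ℝ)).roots.countP (2 < ·) ≤ 1

theorem eval_map_intCast_eq_aeval (x : ℝ) (T : ℤ[X]) :
    (T.map (Int.castRingHom ℝ)).eval x = aeval x T := by
  rw [eval_map, ← algebraMap_int_eq, aeval_def]

namespace IsSalemTrace

theorem of_alternating {T : ℤ[X]} {n : ℕ} {y : ℕ → ℝ} {c : ℝ} (hT : T.Monic)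
    (hdeg : T.natDegree = n + 1) (hy : StrictAntiOn y (Set.Iic n)) (hn : -2 ≤ y n) (h0 : y 0 ≤ 2)
    (hsgn : ∀ i ≤ n, 0 ≤ (-1) ^ (i + 1) * aeval (y i) T) (hc : 2 < c) (hTc : 0 < aeval c T) :
    IsSalemTrace c T := by
  simp only [← eval_map_intCast_eq_aeval] at hsgn hTc
  obtain ⟨r, hr, T₁, hfac, hsgn₁⟩ :=
    exists_eq_X_sub_C_mul_of_alternating hy (h0.trans_lt hc) hTc.le hsgn
  have hmonic := hT.map (Int.castRingHom ℝ)
  have hdeg' := natDegree_map_eq_of_injective (RingHom.injective_int (Int.castRingHom ℝ)) T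
  rw [hfac] at hmonic hdeg' hTc
  have hT₁ : T₁.Monic := (monic_X_sub_C r).of_mul_monic_left hmonic
  rw [(monic_X_sub_C r).natDegree_mul hT₁, natDegree_X_sub_C, hdeg, add_comm, add_left_inj] at hdeg'
  obtain ⟨hsplit, hroots⟩ := splits_and_roots_mem_Icc_of_alternating hT₁ hdeg' hy hsgn₁
  have hrc : r ≠ c := by rintro rfl; simp at hTc
  have hyn : y n ≤ y 0 := hy.antitoneOn n.zero_le Set.self_mem_Iic n.zero_le
  have hroots_eq : (T.map (Int.castRingHom ℝ)).roots = r ::ₘ T₁.roots := by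
    rw [hfac, roots_mul hmonic.ne_zero, roots_X_sub_C, Multiset.singleton_add]
  refine ⟨hT, hfac ▸ (Splits.X_sub_C r).mul hsplit, fun s hs => ?_, ?_⟩
  · rw [hroots_eq, Multiset.mem_cons] at hs
    rcases hs with rfl | hs
    · exact ⟨hn.trans (hyn.trans hr.1), hr.2.lt_of_ne hrc⟩
    · exact ⟨hn.trans (hroots s hs).1, ((hroots s hs).2.trans h0).trans_lt hc⟩
  · have : T₁.roots.countP (2 < ·) = 0 :=
      Multiset.countP_eq_zero.2 fun s hs => not_lt.2 ((hroots s hs).2.trans h0)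
    rw [hroots_eq, Multiset.countP_cons, this]
    split_ifs <;> simp

theorem of_mul {c : ℝ} {f g : ℤ[X]} (h : IsSalemTrace c (f * g)) (hf : f.Monic) :
    IsSalemTrace c g := by
  have hle : (g.map (Int.castRingHom ℝ)).roots ≤ ((f * g).map (Int.castRingHom ℝ)).roots :=
    roots.le_of_dvd (h.monic.map _).ne_zero (Polynomial.map_dvd _ (dvd_mul_left g f))
  exact ⟨hf.of_mul_monic_left h.monic,
    h.splits.of_dvd (h.monic.map _).ne_zero (Polynomial.map_dvd _ (dvd_mul_left g f)),
    fun r hr => h.roots_mem r (Multiset.mem_of_le hle hr),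
    (Multiset.countP_le_of_le _ hle).trans h.countP_roots_le_one⟩

theorem exists_mem_roots_eq {c : ℝ} {T : ℤ[X]} (h : IsSalemTrace c T) {z : ℂ}
    (hz : aeval z T = 0) : ∃ r ∈ (T.map (Int.castRingHom ℝ)).roots, z = r := by
  have hT₀ := (h.monic.map (Int.castRingHom ℝ)).ne_zero
  have hz' : ((T.map (Int.castRingHom ℝ)).map Complex.ofRealHom).IsRoot z := by
    rwa [IsRoot, eval_map, eval₂_map, RingHom.ext_int (Complex.ofRealHom.comp _) (algebraMap ℤ ℂ)]
  obtain ⟨r, rfl⟩ := h.splits.mem_range_of_isRoot hT₀ hz'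
  exact ⟨r, (mem_roots hT₀).2 (hz'.of_map Complex.ofRealHom.injective), rfl⟩

end IsSalemTrace

/-! ### Kronecker's theorem and irreducibility -/

theorem eq_or_eq_inv_of_add_inv_eq {K : Type*} [Field K] {z w : K} (hz : z ≠ 0) (hw : w ≠ 0)
    (h : z + z⁻¹ = w + w⁻¹) : z = w ∨ z = w⁻¹ := by
  have : (z - w) * (z * w - 1) = 0 := by
    field_simp at h
    linear_combination h
  rcases mul_eq_zero.1 this with h | h
  · exact Or.inl (sub_eq_zero.1 h)
  · exact Or.inr (eq_inv_of_mul_eq_one_left (sub_eq_zero.1 h))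

theorem exists_norm_eq_one_add_inv_eq {r : ℝ} (hr : |r| ≤ 2) :
    ∃ z : ℂ, ‖z‖ = 1 ∧ z + z⁻¹ = r := by
  obtain ⟨hl, hu⟩ := abs_le.1 hr
  refine ⟨Complex.exp (Real.arccos (r / 2) * Complex.I), Complex.norm_exp_ofReal_mul_I _, ?_⟩
  rw [← Complex.exp_neg, ← neg_mul, ← Complex.two_cos, ← Complex.ofReal_cos,
    Real.cos_arccos (by linarith) (by linarith)]
  push_cast
  ring

theorem norm_eq_one_of_add_inv_eq {z : ℂ} {r : ℝ} (hr : |r| ≤ 2) (hz : z ≠ 0)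
    (h : z + z⁻¹ = r) : ‖z‖ = 1 := by
  obtain ⟨w, hw, hwr⟩ := exists_norm_eq_one_add_inv_eq hr
  have hw₀ : w ≠ 0 := norm_ne_zero_iff.1 (by simp [hw])
  rcases eq_or_eq_inv_of_add_inv_eq hz hw₀ (h.trans hwr.symm) with rfl | rfl
  · exact hw
  · rw [norm_inv, hw, inv_one]

theorem exists_add_inv_eq {K : Type*} [Field K] [IsAlgClosed K] (x : K) :
    ∃ z : K, z ≠ 0 ∧ z + z⁻¹ = x := by
  have hdeg : (X ^ 2 - C x * X + 1 : K[X]).degree ≠ 0 := by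
    rw [show (X ^ 2 - C x * X + 1 : K[X]).degree = 2 by compute_degree!]
    decide
  obtain ⟨z, hz⟩ := IsAlgClosed.exists_root _ hdeg
  simp only [IsRoot, eval_add, eval_sub, eval_pow, eval_X, eval_mul, eval_C, eval_one] at hz
  have hz₀ : z ≠ 0 := by rintro rfl; simp at hz
  refine ⟨z, hz₀, ?_⟩
  field_simp
  linear_combination hz

theorem isIntegral_of_isIntegral_add_inv {R K : Type*} [CommRing R] [Field K] [Algebra R K] {z : K}
    (hz : z ≠ 0) (h : IsIntegral R (z + z⁻¹)) : IsIntegral R z := by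
  let x : integralClosure R K := ⟨z + z⁻¹, h⟩
  have : IsIntegral (integralClosure R K) z := by
    refine ⟨X ^ 2 - C x * X + 1, by monicity!, ?_⟩
    simp only [eval₂_add, eval₂_sub, eval₂_mul, eval₂_X_pow, eval₂_X, eval₂_C, eval₂_one]
    change z ^ 2 - (z + z⁻¹) * z + 1 = 0
    field_simp
    ring
  exact isIntegral_trans _ this

open IntermediateField in
/-- Kronecker's theorem, in terms of the trace `z + z⁻¹`. -/
theorem isOfFinOrder_of_aeval_add_inv_eq_zero {f : ℤ[X]} (hf : f.Monic)
    (hroots : ∀ x : ℂ, aeval x f = 0 → ∃ r : ℝ, |r| ≤ 2 ∧ x = r) {z : ℂ} (hz : z ≠ 0)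
    (hzf : aeval (z + z⁻¹) f = 0) : IsOfFinOrder z := by
  have hint : IsIntegral ℤ z := isIntegral_of_isIntegral_add_inv hz ⟨f, hf, by rwa [← aeval_def]⟩
  have := adjoin.finiteDimensional (hint.tower_top : IsIntegral ℚ z)
  have : NumberField ℚ⟮z⟯ := ⟨⟩
  have hgen : algebraMap ℚ⟮z⟯ ℂ (AdjoinSimple.gen ℚ z) = z := AdjoinSimple.algebraMap_gen ℚ z
  set g := AdjoinSimple.gen ℚ z
  have hg₀ : g ≠ 0 := by rintro h; simp [← hgen, h] at hz
  have hgint : IsIntegral ℤ g := by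
    rwa [← isIntegral_algebraMap_iff (algebraMap ℚ⟮z⟯ ℂ).injective, hgen]
  have hgf : aeval (g + g⁻¹) f = 0 := (algebraMap ℚ⟮z⟯ ℂ).injective <| by
    rwa [← aeval_algebraMap_apply, map_add, map_inv₀, hgen, map_zero]
  have hnorm : ∀ φ : ℚ⟮z⟯ →+* ℂ, ‖φ g‖ = 1 := fun φ => by
    have hφ : aeval (φ g + (φ g)⁻¹) f = 0 := by
      have := aeval_algHom_apply φ.toIntAlgHom (g + g⁻¹) f
      rw [hgf, map_zero] at this
      simpa using this
    obtain ⟨r, hr, hφr⟩ := hroots _ hφ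
    exact norm_eq_one_of_add_inv_eq hr (by simpa using hg₀) hφr
  obtain ⟨n, hn, hpow⟩ := NumberField.Embeddings.pow_eq_one_of_norm_eq_one ℚ⟮z⟯ ℂ hgint hnorm
  refine isOfFinOrder_iff_pow_eq_one.2 ⟨n, hn, ?_⟩
  rw [← hgen, ← map_pow, hpow, map_one]

theorem exists_isOfFinOrder_aeval_add_inv_eq_zero {f : ℤ[X]} (hf : f.Monic) (hdeg : f.natDegree ≠ 0)
    (hroots : ∀ x : ℂ, aeval x f = 0 → ∃ r : ℝ, |r| ≤ 2 ∧ x = r) :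
    ∃ z : ℂ, IsOfFinOrder z ∧ aeval (z + z⁻¹) f = 0 := by
  obtain ⟨x, hx⟩ := IsAlgClosed.exists_aeval_eq_zero ℂ f (degree_ne_of_natDegree_ne hdeg)
  obtain ⟨z, hz, rfl⟩ := exists_add_inv_eq x
  exact ⟨z, isOfFinOrder_of_aeval_add_inv_eq_zero hf hroots hz hx, hx⟩

/-- No root of `T` is the trace `ζ + ζ⁻¹` of a root of unity `ζ`, so that the reciprocal polynomial
`t ^ deg T * T (t + t⁻¹)` has no cyclotomic factor. -/
def CyclotomicFree (T : ℤ[X]) : Prop :=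
  ∀ ζ : ℂ, IsOfFinOrder ζ → aeval (ζ + ζ⁻¹) T ≠ 0

theorem CyclotomicFree.of_mul_left {f g : ℤ[X]} (h : CyclotomicFree (f * g)) : CyclotomicFree f :=
  fun ζ hζ h₀ => h ζ hζ (by rw [map_mul, h₀, zero_mul])

namespace IsSalemTrace

theorem natDegree_eq_zero {c : ℝ} {f : ℤ[X]} (h : IsSalemTrace c f) (hcyc : CyclotomicFree f)
    (hf : (f.map (Int.castRingHom ℝ)).roots.countP (2 < ·) = 0) : f.natDegree = 0 := by
  by_contra hdeg
  obtain ⟨ζ, hζ, h₀⟩ := exists_isOfFinOrder_aeval_add_inv_eq_zero h.monic hdeg fun x hx => by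
    obtain ⟨r, hr, rfl⟩ := h.exists_mem_roots_eq hx
    exact ⟨r, abs_le.2 ⟨(h.roots_mem r hr).1, not_lt.1 (Multiset.countP_eq_zero.1 hf r hr)⟩, rfl⟩
  exact hcyc ζ hζ h₀

theorem irreducible {c : ℝ} {T : ℤ[X]} (h : IsSalemTrace c T) (hdeg : T.natDegree ≠ 0)
    (hcyc : CyclotomicFree T) : Irreducible T := by
  rw [h.monic.irreducible_iff_natDegree]
  refine ⟨fun h₁ => hdeg (h₁ ▸ natDegree_one), ?_⟩
  rintro f g hf hg rfl
  have hcount := h.countP_roots_le_one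
  rw [Polynomial.map_mul, roots_mul ((hf.map _).mul (hg.map _)).ne_zero, Multiset.countP_add]
    at hcount
  have hf' : IsSalemTrace c f := (mul_comm f g ▸ h).of_mul hg
  have hf₀ := hf'.natDegree_eq_zero hcyc.of_mul_left
  have hg₀ := (h.of_mul hf).natDegree_eq_zero (mul_comm f g ▸ hcyc).of_mul_left
  omega

end IsSalemTrace

/-! ### Roots of unity at which Salem's polynomials vanish -/

section RootsOfUnity

variable {K : Type*} [Field K] [CharZero K] {ζ : K}

theorem aeval_eq_zero_of_isConjRoot {ξ : K} (hζ : IsIntegral ℤ ζ) (h : IsConjRoot ℤ ζ ξ) {P : ℤ[X]}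
    (hP : aeval ζ P = 0) : aeval ξ P = 0 :=
  aeval_eq_zero_of_dvd_aeval_eq_zero (minpoly.isIntegrallyClosed_dvd hζ hP) h.aeval_eq_zero

theorem isConjRoot_neg_or_sq_or_neg_sq (hζ : IsOfFinOrder ζ) :
    IsConjRoot ℤ ζ (-ζ) ∨ IsConjRoot ℤ ζ (ζ ^ 2) ∨ IsConjRoot ℤ ζ (-ζ ^ 2) := by
  have hprim := IsPrimitiveRoot.orderOf ζ
  have hconj : ∀ k : ℕ, k.Coprime (orderOf ζ) → IsConjRoot ℤ ζ (ζ ^ k) := fun k hk =>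
    hprim.minpoly_eq_pow_coprime hk
  obtain ⟨k, hk | hk⟩ := Nat.even_or_odd' (orderOf ζ)
  · have hneg : ζ ^ k = -1 :=
      (hprim.pow hζ.orderOf_pos (hk.trans (mul_comm 2 k))).eq_neg_one_of_two_right
    obtain ⟨j, rfl | rfl⟩ := Nat.even_or_odd' k
    · left
      have := hconj (2 * j + 1) (by simp [hk, Nat.coprime_mul_iff_right])
      rwa [pow_succ, hneg, neg_one_mul] at this
    · right; right
      have hcop : (2 * j + 1 + 2).Coprime (2 * (2 * j + 1)) :=
        Nat.Coprime.mul_right (by simp [show 2 * j + 1 + 2 = 2 * (j + 1) + 1 by ring]) (by simp)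
      have := hconj (2 * j + 1 + 2) (hk ▸ hcop)
      rwa [pow_add, hneg, neg_one_mul] at this
  · right; left
    exact hconj 2 (by simp [hk])

theorem isPrimitiveRoot_three_iff : IsPrimitiveRoot ζ 3 ↔ ζ ^ 2 + ζ + 1 = 0 := by
  simp [← isRoot_cyclotomic_iff_charZero, cyclotomic_three]

theorem isPrimitiveRoot_five_iff : IsPrimitiveRoot ζ 5 ↔ ζ ^ 4 + ζ ^ 3 + ζ ^ 2 + ζ + 1 = 0 := by
  have : Fact (Nat.Prime 5) := ⟨by norm_num⟩
  simp [← isRoot_cyclotomic_iff_charZero, cyclotomic_prime, Finset.sum_range_succ']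

theorem isPrimitiveRoot_eight_iff : IsPrimitiveRoot ζ 8 ↔ ζ ^ 4 + 1 = 0 := by
  have h₄ := cyclotomic_expand_eq_cyclotomic Nat.prime_two (dvd_refl 2) K
  have h₈ := cyclotomic_expand_eq_cyclotomic Nat.prime_two (Dvd.intro 2 rfl : 2 ∣ 2 * 2) K
  rw [← isRoot_cyclotomic_iff_charZero (by simp), ← h₈, ← h₄]
  simp [← pow_mul]

theorem isPrimitiveRoot_twelve_iff : IsPrimitiveRoot ζ 12 ↔ ζ ^ 4 - ζ ^ 2 + 1 = 0 := by
  have h := cyclotomic_expand_eq_cyclotomic Nat.prime_two (by decide : 2 ∣ 6) K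
  rw [← isRoot_cyclotomic_iff_charZero (by simp), ← h, cyclotomic_six]
  simp [← pow_mul]

theorem isPrimitiveRoot_eighteen_iff : IsPrimitiveRoot ζ 18 ↔ ζ ^ 6 - ζ ^ 3 + 1 = 0 := by
  have h := cyclotomic_expand_eq_cyclotomic Nat.prime_three (by decide : 3 ∣ 6) K
  rw [← isRoot_cyclotomic_iff_charZero (by simp), ← h, cyclotomic_six]
  simp [← pow_mul]

theorem isPrimitiveRoot_thirty_iff :
    IsPrimitiveRoot ζ 30 ↔ ζ ^ 8 + ζ ^ 7 - ζ ^ 5 - ζ ^ 4 - ζ ^ 3 + ζ + 1 = 0 := by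
  have h : cyclotomic 30 K = X ^ 8 + X ^ 7 - X ^ 5 - X ^ 4 - X ^ 3 + X + 1 := by
    refine mul_right_cancel₀ (cyclotomic_ne_zero 6 K) ?_
    rw [← cyclotomic_expand_eq_cyclotomic_mul (n := 6) Nat.prime_five (by decide) K,
      cyclotomic_six]
    simp only [map_add, map_sub, map_pow, expand_X, map_one]
    ring
  simp [← isRoot_cyclotomic_iff_charZero, h]

end RootsOfUnity

/-- Salem's polynomials `t ^ m * P t - ε * P⋆ t`, where `P = t ^ 3 - t - 1` is the minimal
polynomial of the smallest Pisot number and `P⋆` is its reciprocal up to sign. -/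
noncomputable def salemPoly (ε : ℤ) (m : ℕ) : ℤ[X] :=
  X ^ m * (X ^ 3 - X - 1) - C ε * (X ^ 3 + X ^ 2 - 1)

theorem aeval_salemPoly {R : Type*} [CommRing R] (t : R) (ε : ℤ) (m : ℕ) :
    aeval t (salemPoly ε m) = t ^ m * (t ^ 3 - t - 1) - ε * (t ^ 3 + t ^ 2 - 1) := by
  simp [salemPoly]

/-- Lehmer's polynomial, which vanishes at `ζ ≠ 0` as soon as `salemPoly 1 m` vanishes at both `ζ`
and `ζ ^ 2`: it is what eliminating `ζ ^ m` leaves. -/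
noncomputable def lehmerPoly : ℤ[X] :=
  X ^ 10 + X ^ 9 - X ^ 7 - X ^ 6 - X ^ 5 - X ^ 4 - X ^ 3 + X + 1

theorem trace_eq_zero_of_aeval_lehmerPoly {K : Type*} [Field K] {ζ : K} (hζ : ζ ≠ 0)
    (h : aeval ζ lehmerPoly = 0) :
    (ζ + ζ⁻¹) ^ 5 + (ζ + ζ⁻¹) ^ 4 - 5 * (ζ + ζ⁻¹) ^ 3 - 5 * (ζ + ζ⁻¹) ^ 2 + 4 * (ζ + ζ⁻¹) + 3
      = 0 := by
  simp only [lehmerPoly, map_add, map_sub, map_pow, aeval_X, map_one] at h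
  field_simp
  linear_combination h

section SalemPoly

variable {K : Type*} [Field K] [CharZero K] {ζ : K} {m : ℕ} {ε : ℤ}

theorem modEq_of_aeval_salemPoly_eq_zero {d a : ℕ} [NeZero d] (hζ : IsPrimitiveRoot ζ d)
    (hε : ε ≠ 0) (hm : aeval ζ (salemPoly ε m) = 0) (ha : aeval ζ (salemPoly ε a) = 0) :
    m ≡ a [MOD d] := by
  rw [aeval_salemPoly] at hm ha
  have hP : ζ ^ 3 - ζ - 1 ≠ 0 := fun hP => by
    have hP' : ζ ^ 3 + ζ ^ 2 - 1 = 0 := by simpa [hP, hε] using hm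
    exact one_ne_zero (α := K) (by linear_combination -ζ * hP + (ζ - 1) * hP')
  rw [hζ.eq_orderOf, ← (hζ.isOfFinOrder (NeZero.ne d)).pow_eq_pow_iff_modEq]
  exact mul_right_cancel₀ hP (by linear_combination hm - ha)

theorem sq_eq_one_or_isPrimitiveRoot_eight_of_neg (hζ : ζ ≠ 0) (hm : Odd m)
    (h : aeval ζ (salemPoly ε m) = 0) (h' : aeval (-ζ) (salemPoly ε m) = 0) :
    ζ ^ 2 = 1 ∨ IsPrimitiveRoot ζ 8 := by
  rw [aeval_salemPoly] at h h'
  rw [hm.neg_pow] at h'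
  have : 2 * ζ ^ m * ((ζ ^ 2 - 1) * (ζ ^ 4 + 1)) = 0 := by
    linear_combination (ζ ^ 3 - ζ ^ 2 + 1) * h + (ζ ^ 3 + ζ ^ 2 - 1) * h'
  simpa [hζ, sub_eq_zero, isPrimitiveRoot_eight_iff] using this

theorem isPrimitiveRoot_twelve_of_neg (hζ : ζ ≠ 0) (hm : Even m)
    (h : aeval ζ (salemPoly ε m) = 0) (h' : aeval (-ζ) (salemPoly ε m) = 0) :
    IsPrimitiveRoot ζ 12 := by
  rw [aeval_salemPoly] at h h'
  rw [hm.neg_pow] at h'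
  have : 2 * ζ ^ m * (ζ * (ζ ^ 4 - ζ ^ 2 + 1)) = 0 := by
    linear_combination (-ζ ^ 3 + ζ ^ 2 - 1) * h - (ζ ^ 3 + ζ ^ 2 - 1) * h'
  simpa [hζ, isPrimitiveRoot_twelve_iff] using this

theorem sq_eq_one_or_isPrimitiveRoot_of_sq (hζ : ζ ≠ 0)
    (h : aeval ζ (salemPoly (-1) m) = 0) (h' : aeval (ζ ^ 2) (salemPoly (-1) m) = 0) :
    ζ ^ 2 = 1 ∨ IsPrimitiveRoot ζ 3 ∨ IsPrimitiveRoot ζ 5 := by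
  rw [aeval_salemPoly] at h h'
  rw [← pow_mul, mul_comm 2 m, pow_mul] at h'
  push_cast at h h'
  have : 2 * (ζ ^ m) ^ 2 * ((ζ ^ 2 - 1) ^ 3 * ((ζ ^ 2 + ζ + 1) ^ 2 *
      (ζ ^ 4 + ζ ^ 3 + ζ ^ 2 + ζ + 1))) = 0 := by
    linear_combination (ζ + 1) ^ 2 * ((ζ ^ 3 + ζ ^ 2 - 1) ^ 2 * h' +
      (ζ ^ 6 + ζ ^ 4 - 1) * (ζ ^ m * (ζ ^ 3 - ζ - 1) - (ζ ^ 3 + ζ ^ 2 - 1)) * h)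
  simpa [hζ, sub_eq_zero, isPrimitiveRoot_three_iff, isPrimitiveRoot_five_iff] using this

theorem sq_eq_one_or_isPrimitiveRoot_eighteen_of_neg_sq (hζ : ζ ≠ 0) (hε : (-1) ^ m = ε)
    (h : aeval ζ (salemPoly ε m) = 0) (h' : aeval (-ζ ^ 2) (salemPoly ε m) = 0) :
    ζ ^ 2 = 1 ∨ IsPrimitiveRoot ζ 18 := by
  subst hε
  have hsq : ((-1 : K) ^ m) ^ 2 = 1 := by rw [← pow_mul, mul_comm, pow_mul, neg_one_sq, one_pow]
  rw [aeval_salemPoly] at h h'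
  rw [neg_pow, ← pow_mul, mul_comm 2 m, pow_mul] at h'
  push_cast at h h'
  have : 2 * (-1) ^ m * (ζ ^ m) ^ 2 * ζ * ((ζ ^ 2 - 1) ^ 3 * (ζ ^ 6 - ζ ^ 3 + 1)) = 0 := by
    linear_combination (ζ - 1) ^ 2 * (-(ζ ^ 3 + ζ ^ 2 - 1) ^ 2 * h' -
      (ζ ^ 6 - ζ ^ 4 + 1) * (-1) ^ m * ((ζ ^ 3 + ζ ^ 2 - 1) ^ 2 * hsq +
        (ζ ^ m * (ζ ^ 3 - ζ - 1) + (-1) ^ m * (ζ ^ 3 + ζ ^ 2 - 1)) * h))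
  simpa [hζ, sub_eq_zero, isPrimitiveRoot_eighteen_iff] using this

theorem isPrimitiveRoot_twelve_or_thirty_of_neg_sq (hζ : ζ ≠ 0) (hm : Even m)
    (h : aeval ζ (salemPoly (-1) m) = 0) (h' : aeval (-ζ ^ 2) (salemPoly (-1) m) = 0) :
    IsPrimitiveRoot ζ 12 ∨ IsPrimitiveRoot ζ 30 := by
  rw [aeval_salemPoly] at h h'
  rw [hm.neg_pow, ← pow_mul, mul_comm 2 m, pow_mul] at h'
  push_cast at h h'
  have : 2 * (ζ ^ m) ^ 2 * ((ζ ^ 4 - ζ ^ 2 + 1) *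
      (ζ ^ 8 + ζ ^ 7 - ζ ^ 5 - ζ ^ 4 - ζ ^ 3 + ζ + 1)) = 0 := by
    linear_combination -(ζ ^ 3 + ζ ^ 2 - 1) ^ 2 * h' +
      (ζ ^ 6 - ζ ^ 4 + 1) * (ζ ^ m * (ζ ^ 3 - ζ - 1) - (ζ ^ 3 + ζ ^ 2 - 1)) * h
  simpa [hζ, isPrimitiveRoot_twelve_iff, isPrimitiveRoot_thirty_iff] using this

theorem aeval_sq_lehmerPoly_ne_zero (hζ : ζ ≠ 0) (h : aeval ζ lehmerPoly = 0) :
    aeval (ζ ^ 2) lehmerPoly ≠ 0 := fun h' => by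
  have hy := trace_eq_zero_of_aeval_lehmerPoly hζ h
  have hy' := trace_eq_zero_of_aeval_lehmerPoly (pow_ne_zero 2 hζ) h'
  rw [show ζ ^ 2 + (ζ ^ 2)⁻¹ = (ζ + ζ⁻¹) ^ 2 - 2 by field_simp; ring] at hy'
  set y := ζ + ζ⁻¹
  have : (2 : K) = 0 := by
    linear_combination
      (-y ^ 9 + 9 * y ^ 7 - y ^ 6 - 26 * y ^ 5 + 6 * y ^ 4 + 25 * y ^ 3 - 9 * y ^ 2 - 4 * y + 2)
        * hy + (y ^ 4 + y ^ 3 - 5 * y ^ 2 - 4 * y + 4) * hy'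
  exact two_ne_zero this

theorem aeval_lehmerPoly_eq_zero_of_sq (hζ : ζ ≠ 0)
    (h : aeval ζ (salemPoly 1 m) = 0) (h' : aeval (ζ ^ 2) (salemPoly 1 m) = 0) :
    aeval ζ lehmerPoly = 0 := by
  rw [aeval_salemPoly] at h h'
  rw [← pow_mul, mul_comm 2 m, pow_mul] at h'
  push_cast at h h'
  have : 2 * (ζ ^ m) ^ 2 * ζ * aeval ζ lehmerPoly = 0 := by
    simp only [lehmerPoly, map_add, map_sub, map_pow, aeval_X, map_one]
    linear_combination (ζ ^ 3 + ζ ^ 2 - 1) ^ 2 * h' -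
      (ζ ^ 6 + ζ ^ 4 - 1) * (ζ ^ m * (ζ ^ 3 - ζ - 1) + (ζ ^ 3 + ζ ^ 2 - 1)) * h
  simpa [hζ] using this

theorem modEq_one_of_isPrimitiveRoot_three (hζ : IsPrimitiveRoot ζ 3)
    (h : aeval ζ (salemPoly (-1) m) = 0) : m ≡ 1 [MOD 3] := by
  refine modEq_of_aeval_salemPoly_eq_zero hζ (by decide) h ?_
  rw [aeval_salemPoly]
  push_cast
  linear_combination (ζ ^ 2 - 1) * isPrimitiveRoot_three_iff.1 hζ

theorem modEq_two_of_isPrimitiveRoot_five (hζ : IsPrimitiveRoot ζ 5)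
    (h : aeval ζ (salemPoly (-1) m) = 0) : m ≡ 2 [MOD 5] := by
  refine modEq_of_aeval_salemPoly_eq_zero hζ (by decide) h ?_
  rw [aeval_salemPoly]
  push_cast
  linear_combination (ζ - 1) * isPrimitiveRoot_five_iff.1 hζ

theorem modEq_three_of_isPrimitiveRoot_eight (hζ : IsPrimitiveRoot ζ 8)
    (h : aeval ζ (salemPoly (-1) m) = 0) : m ≡ 3 [MOD 8] := by
  refine modEq_of_aeval_salemPoly_eq_zero hζ (by decide) h ?_
  rw [aeval_salemPoly]
  push_cast
  linear_combination (ζ ^ 2 - 1) * isPrimitiveRoot_eight_iff.1 hζ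

theorem modEq_four_of_isPrimitiveRoot_twelve (hζ : IsPrimitiveRoot ζ 12)
    (h : aeval ζ (salemPoly (-1) m) = 0) : m ≡ 4 [MOD 12] := by
  refine modEq_of_aeval_salemPoly_eq_zero hζ (by decide) h ?_
  rw [aeval_salemPoly]
  push_cast
  linear_combination (ζ ^ 3 - 1) * isPrimitiveRoot_twelve_iff.1 hζ

theorem modEq_five_of_isPrimitiveRoot_eighteen (hζ : IsPrimitiveRoot ζ 18)
    (h : aeval ζ (salemPoly (-1) m) = 0) : m ≡ 5 [MOD 18] := by
  refine modEq_of_aeval_salemPoly_eq_zero hζ (by decide) h ?_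
  rw [aeval_salemPoly]
  push_cast
  linear_combination (ζ ^ 2 - 1) * isPrimitiveRoot_eighteen_iff.1 hζ

theorem modEq_six_of_isPrimitiveRoot_thirty (hζ : IsPrimitiveRoot ζ 30)
    (h : aeval ζ (salemPoly (-1) m) = 0) : m ≡ 6 [MOD 30] := by
  refine modEq_of_aeval_salemPoly_eq_zero hζ (by decide) h ?_
  rw [aeval_salemPoly]
  push_cast
  linear_combination (ζ - 1) * isPrimitiveRoot_thirty_iff.1 hζ

theorem modEq_ten_of_isPrimitiveRoot_twelve (hζ : IsPrimitiveRoot ζ 12)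
    (h : aeval ζ (salemPoly 1 m) = 0) : m ≡ 10 [MOD 12] := by
  refine modEq_of_aeval_salemPoly_eq_zero hζ (by decide) h ?_
  rw [aeval_salemPoly]
  push_cast
  linear_combination (ζ ^ 9 - ζ ^ 6 - ζ ^ 5 - ζ ^ 4 - ζ ^ 3 + 1) * isPrimitiveRoot_twelve_iff.1 hζ

theorem modEq_fourteen_of_isPrimitiveRoot_eighteen (hζ : IsPrimitiveRoot ζ 18)
    (h : aeval ζ (salemPoly 1 m) = 0) : m ≡ 14 [MOD 18] := by
  refine modEq_of_aeval_salemPoly_eq_zero hζ (by decide) h ?_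
  rw [aeval_salemPoly]
  push_cast
  linear_combination (ζ ^ 11 - ζ ^ 9 - ζ ^ 6 - ζ ^ 5 - ζ ^ 2 + 1) *
    isPrimitiveRoot_eighteen_iff.1 hζ

theorem isPrimitiveRoot_of_aeval_salemPoly_neg_one_of_odd (hζ : IsOfFinOrder ζ) (hm : Odd m)
    (h : aeval ζ (salemPoly (-1) m) = 0) :
    ζ ^ 2 = 1 ∨ (IsPrimitiveRoot ζ 3 ∧ m ≡ 1 [MOD 3]) ∨ (IsPrimitiveRoot ζ 5 ∧ m ≡ 2 [MOD 5]) ∨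
      m ≡ 3 [MOD 8] ∨ m ≡ 5 [MOD 18] := by
  have hconj {ξ : K} (hξ : IsConjRoot ℤ ζ ξ) := aeval_eq_zero_of_isConjRoot
    ((IsPrimitiveRoot.orderOf ζ).isIntegral hζ.orderOf_pos) hξ h
  have hζ₀ : ζ ≠ 0 := hζ.isUnit.ne_zero
  rcases isConjRoot_neg_or_sq_or_neg_sq hζ with hc | hc | hc
  · have := sq_eq_one_or_isPrimitiveRoot_eight_of_neg hζ₀ hm h (hconj hc)
    have := fun hd => modEq_three_of_isPrimitiveRoot_eight hd h
    tauto
  · have := sq_eq_one_or_isPrimitiveRoot_of_sq hζ₀ h (hconj hc)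
    have := fun hd => modEq_one_of_isPrimitiveRoot_three hd h
    have := fun hd => modEq_two_of_isPrimitiveRoot_five hd h
    tauto
  · have := sq_eq_one_or_isPrimitiveRoot_eighteen_of_neg_sq hζ₀ hm.neg_one_pow h (hconj hc)
    have := fun hd => modEq_five_of_isPrimitiveRoot_eighteen hd h
    tauto

theorem isPrimitiveRoot_of_aeval_salemPoly_neg_one_of_even (hζ : IsOfFinOrder ζ) (hm : Even m)
    (h : aeval ζ (salemPoly (-1) m) = 0) :
    ζ ^ 2 = 1 ∨ (IsPrimitiveRoot ζ 3 ∧ m ≡ 1 [MOD 3]) ∨ (IsPrimitiveRoot ζ 5 ∧ m ≡ 2 [MOD 5]) ∨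
      m ≡ 4 [MOD 12] ∨ m ≡ 6 [MOD 30] := by
  have hconj {ξ : K} (hξ : IsConjRoot ℤ ζ ξ) := aeval_eq_zero_of_isConjRoot
    ((IsPrimitiveRoot.orderOf ζ).isIntegral hζ.orderOf_pos) hξ h
  have hζ₀ : ζ ≠ 0 := hζ.isUnit.ne_zero
  have h₁₂ := fun hd => modEq_four_of_isPrimitiveRoot_twelve hd h
  rcases isConjRoot_neg_or_sq_or_neg_sq hζ with hc | hc | hc
  · have := isPrimitiveRoot_twelve_of_neg hζ₀ hm h (hconj hc)
    tauto
  · have := sq_eq_one_or_isPrimitiveRoot_of_sq hζ₀ h (hconj hc)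
    have := fun hd => modEq_one_of_isPrimitiveRoot_three hd h
    have := fun hd => modEq_two_of_isPrimitiveRoot_five hd h
    tauto
  · have := isPrimitiveRoot_twelve_or_thirty_of_neg_sq hζ₀ hm h (hconj hc)
    have := fun hd => modEq_six_of_isPrimitiveRoot_thirty hd h
    tauto

theorem isPrimitiveRoot_of_aeval_salemPoly_one_of_even (hζ : IsOfFinOrder ζ) (hm : Even m)
    (h : aeval ζ (salemPoly 1 m) = 0) :
    ζ ^ 2 = 1 ∨ m ≡ 10 [MOD 12] ∨ m ≡ 14 [MOD 18] := by
  have hconj {ξ : K} (hξ : IsConjRoot ℤ ζ ξ) {P : ℤ[X]} (hP : aeval ζ P = 0) :=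
    aeval_eq_zero_of_isConjRoot
      ((IsPrimitiveRoot.orderOf ζ).isIntegral hζ.orderOf_pos) hξ hP
  have hζ₀ : ζ ≠ 0 := hζ.isUnit.ne_zero
  rcases isConjRoot_neg_or_sq_or_neg_sq hζ with hc | hc | hc
  · have := isPrimitiveRoot_twelve_of_neg hζ₀ hm h (hconj hc h)
    exact .inr (.inl (modEq_ten_of_isPrimitiveRoot_twelve this h))
  · have hL := aeval_lehmerPoly_eq_zero_of_sq hζ₀ h (hconj hc h)
    exact absurd (hconj hc hL) (aeval_sq_lehmerPoly_ne_zero hζ₀ hL)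
  · have := sq_eq_one_or_isPrimitiveRoot_eighteen_of_neg_sq hζ₀ hm.neg_one_pow h (hconj hc h)
    have := fun hd => modEq_fourteen_of_isPrimitiveRoot_eighteen hd h
    tauto

end SalemPoly

/-! ### The polynomials in the trace variable -/

/-- The characteristic polynomial of a Coxeter element of `E_n`, `n = 2 * d + 1`, in the trace
variable `t + t⁻¹` and without its factor `t + 1`. It has degree `d`, except that `d = 0` only
continues the recursion. -/
noncomputable def coxeterTrace : ℕ → ℤ[X]
  | 0 => X + 2
  | 1 => X + 1
  | d + 2 => X * coxeterTrace (d + 1) - coxeterTrace d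

theorem aeval_coxeterTrace_add_two {R : Type*} [CommRing R] (x : R) (d : ℕ) :
    aeval x (coxeterTrace (d + 2)) =
      x * aeval x (coxeterTrace (d + 1)) - aeval x (coxeterTrace d) := by
  rw [coxeterTrace, map_sub, map_mul, aeval_X]

theorem isMonicOfDegree_coxeterTrace_succ (d : ℕ) :
    IsMonicOfDegree (coxeterTrace (d + 1)) (d + 1) := by
  induction d using Nat.twoStepInduction with
  | zero => exact isMonicOfDegree_X_add_one 1
  | one =>
    convert isMonicOfDegree_add_add_two (0 : ℤ) (-2) using 1
    simp only [coxeterTrace, map_zero, map_neg, map_ofNat]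
    ring
  | more d ih₀ ih₁ =>
    rw [coxeterTrace, add_comm (d + 1 + 1) 1]
    exact ((isMonicOfDegree_X ℤ).mul ih₁).sub (by rw [ih₀.natDegree_eq]; omega)

theorem isMonicOfDegree_coxeterTrace_succ_add (d : ℕ) :
    IsMonicOfDegree (coxeterTrace (d + 2) + coxeterTrace (d + 1)) (d + 2) :=
  (isMonicOfDegree_coxeterTrace_succ (d + 1)).add_right
    (by rw [(isMonicOfDegree_coxeterTrace_succ d).natDegree_eq]; omega)

theorem isMonicOfDegree_coxeterTrace_succ_sub (d : ℕ) :
    IsMonicOfDegree (coxeterTrace (d + 2) - coxeterTrace (d + 1)) (d + 2) :=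
  (isMonicOfDegree_coxeterTrace_succ (d + 1)).sub
    (by rw [(isMonicOfDegree_coxeterTrace_succ d).natDegree_eq]; omega)

theorem coeff_zero_coxeterTrace (k : ℕ) :
    (coxeterTrace (2 * k)).coeff 0 = 2 * (-1) ^ k ∧
      (coxeterTrace (2 * k + 1)).coeff 0 = (-1) ^ k := by
  have hrec (d : ℕ) : (coxeterTrace (d + 2)).coeff 0 = -(coxeterTrace d).coeff 0 := by
    rw [coxeterTrace, coeff_sub, mul_coeff_zero, coeff_X_zero, zero_mul, zero_sub]
  induction k with
  | zero => simp [coxeterTrace]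
  | succ k ih =>
    rw [show 2 * (k + 1) = 2 * k + 2 by ring, show 2 * k + 2 + 1 = 2 * k + 1 + 2 by ring,
      hrec, hrec, ih.1, ih.2]
    constructor <;> ring

theorem aeval_two_coxeterTrace {R : Type*} [CommRing R] (d : ℕ) :
    aeval (2 : R) (coxeterTrace d) = 4 - d := by
  induction d using Nat.twoStepInduction with
  | zero => simp only [coxeterTrace, map_add, aeval_X, map_ofNat, Nat.cast_zero]; ring
  | one => simp only [coxeterTrace, map_add, aeval_X, map_one, Nat.cast_one]; ring
  | more d ih₀ ih₁ =>
    rw [aeval_coxeterTrace_add_two, ih₀, ih₁]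
    push_cast
    ring

theorem aeval_neg_two_coxeterTrace {R : Type*} [CommRing R] (d : ℕ) :
    aeval (-2 : R) (coxeterTrace d) = (-1) ^ d * d := by
  induction d using Nat.twoStepInduction with
  | zero => simp only [coxeterTrace, map_add, aeval_X, map_ofNat, Nat.cast_zero]; ring
  | one => simp only [coxeterTrace, map_add, aeval_X, map_one, Nat.cast_one]; ring
  | more d ih₀ ih₁ =>
    rw [aeval_coxeterTrace_add_two, ih₀, ih₁]
    push_cast
    ring

theorem aeval_neg_one_coxeterTrace {R : Type*} [CommRing R] (k : ℕ) :
    aeval (-1 : R) (coxeterTrace (3 * k)) = 1 ∧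
      aeval (-1 : R) (coxeterTrace (3 * k + 1)) = 0 := by
  induction k with
  | zero =>
    simp only [coxeterTrace, map_add, aeval_X, map_one, map_ofNat]
    constructor <;> ring
  | succ k ih =>
    simp only [show 3 * (k + 1) = 3 * k + 1 + 2 by ring, aeval_coxeterTrace_add_two, ih.1, ih.2,
      show 3 * k + 1 + 2 + 1 = 3 * k + 2 + 2 by ring, show 3 * k + 1 + 1 = 3 * k + 2 by ring,
      show 3 * k + 2 + 1 = 3 * k + 1 + 2 by ring]
    constructor <;> ring

theorem aeval_derivative_coxeterTrace_add_two {R : Type*} [CommRing R] (x : R) (d : ℕ) :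
    aeval x (derivative (coxeterTrace (d + 2))) = aeval x (coxeterTrace (d + 1)) +
      x * aeval x (derivative (coxeterTrace (d + 1))) - aeval x (derivative (coxeterTrace d)) := by
  simp only [coxeterTrace, derivative_mul, derivative_X, map_sub, map_add, map_mul, aeval_X,
    one_mul]

theorem aeval_neg_one_derivative_coxeterTrace {R : Type*} [CommRing R] (k : ℕ) :
    aeval (-1 : R) (derivative (coxeterTrace (3 * k))) = 1 - k ∧
      aeval (-1 : R) (derivative (coxeterTrace (3 * k + 1))) = 2 * k + 1 := by
  induction k with
  | zero => simp [coxeterTrace]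
  | succ k ih =>
    obtain ⟨h₀, h₁⟩ := aeval_neg_one_coxeterTrace (R := R) k
    simp only [show 3 * (k + 1) = 3 * k + 1 + 2 by ring, aeval_derivative_coxeterTrace_add_two,
      ih.1, ih.2, h₀, h₁,
      show 3 * k + 1 + 2 + 1 = 3 * k + 2 + 2 by ring, show 3 * k + 1 + 1 = 3 * k + 2 by ring,
      show 3 * k + 2 + 1 = 3 * k + 1 + 2 by ring, aeval_coxeterTrace_add_two]
    push_cast
    constructor <;> ring

theorem aeval_two_mul_cos_coxeterTrace (θ : ℝ) (d : ℕ) :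
    aeval (2 * Real.cos θ) (coxeterTrace d) * Real.sin θ =
      (2 * Real.cos θ + 2) * Real.sin θ * Real.cos (d * θ) -
        (2 * Real.cos θ ^ 2 - 1) * Real.sin (d * θ) := by
  induction d using Nat.twoStepInduction with
  | zero =>
    simp only [coxeterTrace, map_add, aeval_X, map_ofNat, Nat.cast_zero, zero_mul, Real.cos_zero,
      Real.sin_zero]
    ring
  | one =>
    simp only [coxeterTrace, map_add, aeval_X, map_one, Nat.cast_one, one_mul]
    ring
  | more d ih₀ ih₁ =>
    have hcos := Real.two_mul_cos_mul_cos ((d + 1) * θ) θ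
    have hsin := Real.two_mul_sin_mul_cos ((d + 1) * θ) θ
    rw [show (d + 1) * θ - θ = d * θ by ring, show (d + 1) * θ + θ = (d + 2) * θ by ring]
      at hcos hsin
    rw [aeval_coxeterTrace_add_two]
    push_cast at ih₁ ⊢
    linear_combination 2 * Real.cos θ * ih₁ - ih₀ +
      (2 * Real.cos θ + 2) * Real.sin θ * hcos - (2 * Real.cos θ ^ 2 - 1) * hsin

/-- The extremal points of the Chebyshev polynomial of degree `N`, on the interval `[-2, 2]` and in
decreasing order. -/
noncomputable def chebyshevNode (N j : ℕ) : ℝ :=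
  2 * Real.cos (j * Real.pi / N)

theorem strictAntiOn_chebyshevNode (N : ℕ) : StrictAntiOn (chebyshevNode N) (Set.Iic N) := by
  intro i _ j (hj : j ≤ N) hij
  have hN : (0 : ℝ) < N := by exact_mod_cast (i.zero_le.trans_lt hij).trans_le hj
  have hle : (j : ℝ) * Real.pi / N ≤ Real.pi := by
    rw [div_le_iff₀ hN, mul_comm Real.pi]
    gcongr
  have hlt : (i : ℝ) * Real.pi / N < j * Real.pi / N := by gcongr
  exact mul_lt_mul_of_pos_left (Real.cos_lt_cos_of_nonneg_of_le_pi (by positivity) hle hlt)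
    two_pos

theorem chebyshevNode_zero (N : ℕ) : chebyshevNode N 0 = 2 := by simp [chebyshevNode]

theorem chebyshevNode_self {N : ℕ} (hN : N ≠ 0) : chebyshevNode N N = -2 := by
  rw [chebyshevNode, mul_div_cancel_left₀ _ (Nat.cast_ne_zero.2 hN), Real.cos_pi]
  ring

theorem aeval_chebyshevNode_coxeterTrace {N j : ℕ} (hj : 0 < j) (hjN : j < N) :
    aeval (chebyshevNode N j) (coxeterTrace N) = (-1) ^ j * (chebyshevNode N j + 2) ∧
      aeval (chebyshevNode N j) (coxeterTrace (N + 1)) = (-1) ^ j * (chebyshevNode N j + 1) := by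
  have hN : (0 : ℝ) < N := by exact_mod_cast hj.trans hjN
  set θ := j * Real.pi / N with hθ
  have hNθ : N * θ = j * Real.pi := mul_div_cancel₀ _ hN.ne'
  have hθπ : θ < Real.pi := by
    rw [div_lt_iff₀ hN, mul_comm Real.pi]
    gcongr
  have hsin : Real.sin θ ≠ 0 := (Real.sin_pos_of_pos_of_lt_pi (by positivity) hθπ).ne'
  have hcos := Real.cos_add_nat_mul_pi θ j
  have hsin' := Real.sin_add_nat_mul_pi θ j
  have h₀ := aeval_two_mul_cos_coxeterTrace θ N
  have h₁ := aeval_two_mul_cos_coxeterTrace θ (N + 1)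
  rw [hNθ, Real.cos_nat_mul_pi, Real.sin_nat_mul_pi] at h₀
  rw [Nat.cast_succ, add_one_mul, hNθ, add_comm _ θ, hcos, hsin'] at h₁
  rw [chebyshevNode, ← hθ]
  constructor <;> apply mul_right_cancel₀ hsin
  · linear_combination h₀
  · linear_combination h₁

/-- The ratio `0.7545` is just above the smaller root of `r + r⁻¹ = 2.08`. -/
theorem aeval_coxeterTrace_pos_and_lt (d : ℕ) :
    0 < aeval (2.08 : ℝ) (coxeterTrace d) ∧
      0.7545 * aeval (2.08 : ℝ) (coxeterTrace d) < aeval (2.08 : ℝ) (coxeterTrace (d + 1)) := by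
  induction d with
  | zero =>
    simp only [coxeterTrace, map_add, aeval_X, map_one, map_ofNat]
    norm_num
  | succ d ih =>
    have hpos : 0 < aeval (2.08 : ℝ) (coxeterTrace (d + 1)) := by linarith
    refine ⟨hpos, ?_⟩
    rw [aeval_coxeterTrace_add_two]
    linarith

theorem aeval_coxeterTrace_lt_succ {d : ℕ} (hd : 12 ≤ d) :
    aeval (2.08 : ℝ) (coxeterTrace d) < aeval (2.08 : ℝ) (coxeterTrace (d + 1)) := by
  induction d, hd using Nat.le_induction with
  | base =>
    simp only [coxeterTrace, map_sub, map_add, map_mul, aeval_X, map_one, map_ofNat]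
    norm_num
  | succ d _ ih =>
    rw [aeval_coxeterTrace_add_two]
    linarith [(aeval_coxeterTrace_pos_and_lt (d + 1)).1]

theorem IsSalemTrace.of_alternating_chebyshevNode {T : ℤ[X]} {N : ℕ} {c : ℝ} (hN : N ≠ 0)
    (hT : IsMonicOfDegree T N) (hneg : 0 ≤ (-1) ^ N * aeval (-2 : ℝ) T)
    (hsgn : ∀ i, 0 < i → i < N → 0 ≤ (-1) ^ i * aeval (chebyshevNode N i) T)
    (hc : 2 < c) (hTc : 0 < aeval c T) : IsSalemTrace c T := by
  obtain ⟨n, rfl⟩ := Nat.exists_eq_succ_of_ne_zero hN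
  have hanti := strictAntiOn_chebyshevNode (n + 1)
  have h₀ : chebyshevNode (n + 1) 0 = 2 := chebyshevNode_zero _
  have hn : chebyshevNode (n + 1) (n + 1) = -2 := chebyshevNode_self hN
  refine .of_alternating (y := fun i => chebyshevNode (n + 1) (i + 1)) hT.monic hT.natDegree_eq
    (fun i hi j hj hij => hanti (Nat.succ_le_succ hi) (Nat.succ_le_succ hj)
      (Nat.succ_lt_succ hij)) hn.ge
    (h₀ ▸ hanti.antitoneOn (Nat.zero_le _) (Nat.succ_le_succ n.zero_le) zero_le_one)
    (fun i hi => ?_) hc hTc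
  rcases hi.eq_or_lt with rfl | hi
  · rwa [hn]
  · exact hsgn (i + 1) i.succ_pos (Nat.succ_lt_succ hi)

theorem isSalemTrace_coxeterTrace_succ (d : ℕ) : IsSalemTrace 2.08 (coxeterTrace (d + 1)) := by
  have hpow (i : ℕ) : (-1 : ℝ) ^ i * (-1) ^ i = 1 := pow_mul_pow_eq_one i (by norm_num)
  refine .of_alternating_chebyshevNode d.succ_ne_zero (isMonicOfDegree_coxeterTrace_succ d) ?_
    (fun i hi hid => ?_) (by norm_num) (aeval_coxeterTrace_pos_and_lt _).1
  · rw [aeval_neg_two_coxeterTrace, ← mul_assoc, hpow]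
    positivity
  · have hle : -2 ≤ chebyshevNode (d + 1) i := chebyshevNode_self d.succ_ne_zero ▸
      (strictAntiOn_chebyshevNode (d + 1)).antitoneOn hid.le Set.self_mem_Iic hid.le
    rw [(aeval_chebyshevNode_coxeterTrace hi hid).1, ← mul_assoc, hpow]
    linarith

theorem isSalemTrace_coxeterTrace_succ_add (d : ℕ) :
    IsSalemTrace 2.08 (coxeterTrace (d + 2) + coxeterTrace (d + 1)) := by
  have hpow (i : ℕ) : (-1 : ℝ) ^ i * (-1) ^ i = 1 := pow_mul_pow_eq_one i (by norm_num)
  refine .of_alternating_chebyshevNode (by omega) (isMonicOfDegree_coxeterTrace_succ_add d) ?_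
    (fun i hi hid => ?_) (by norm_num) ?_
  · rw [map_add, aeval_neg_two_coxeterTrace, aeval_neg_two_coxeterTrace]
    calc (0 : ℝ) ≤ 1 := zero_le_one
      _ = _ := by push_cast; linear_combination -hpow d
  · have hrec := aeval_coxeterTrace_add_two (chebyshevNode (d + 2) i) (d + 1)
    obtain ⟨h₀, h₁⟩ := aeval_chebyshevNode_coxeterTrace hi hid
    rw [map_add]
    calc (0 : ℝ) ≤ (chebyshevNode (d + 2) i + 1) ^ 2 := sq_nonneg _
      _ = _ := by
        linear_combination -(chebyshevNode (d + 2) i + 1) ^ 2 * hpow i +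
          (-1) ^ i * (h₁ - hrec - (chebyshevNode (d + 2) i + 1) * h₀)
  · rw [map_add]
    exact add_pos (aeval_coxeterTrace_pos_and_lt _).1 (aeval_coxeterTrace_pos_and_lt _).1

theorem isSalemTrace_coxeterTrace_succ_sub {d : ℕ} (hd : 11 ≤ d) :
    IsSalemTrace 2.08 (coxeterTrace (d + 2) - coxeterTrace (d + 1)) := by
  have hdeg := isMonicOfDegree_coxeterTrace_succ_sub d
  have hself : chebyshevNode (d + 1) (d + 1) = -2 := chebyshevNode_self d.succ_ne_zero
  refine .of_alternating hdeg.monic hdeg.natDegree_eq (strictAntiOn_chebyshevNode (d + 1)) hself.ge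
    (chebyshevNode_zero _).le (fun i hi => ?_) (by norm_num)
    (by rw [map_sub, sub_pos]; exact aeval_coxeterTrace_lt_succ (by omega))
  have hpow : (-1 : ℝ) ^ i * (-1) ^ i = 1 := pow_mul_pow_eq_one i (by norm_num)
  rw [map_sub]
  rcases hi.eq_or_lt with rfl | hid
  · rw [hself, aeval_neg_two_coxeterTrace, aeval_neg_two_coxeterTrace]
    calc (0 : ℝ) ≤ 2 * d + 3 := by positivity
      _ = _ := by push_cast; linear_combination -(2 * d + 3 : ℝ) * hpow
  rcases i.eq_zero_or_pos with rfl | hi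
  · rw [chebyshevNode_zero, aeval_two_coxeterTrace, aeval_two_coxeterTrace]
    push_cast
    linarith
  · obtain ⟨h₀, h₁⟩ := aeval_chebyshevNode_coxeterTrace hi hid
    rw [h₀, h₁]
    calc (0 : ℝ) ≤ 1 := zero_le_one
      _ = _ := by linear_combination -hpow

theorem pow_mul_aeval_add_inv_coxeterTrace {K : Type*} [Field K] {t : K} (ht : t ≠ 0) (d : ℕ) :
    t ^ (d + 1) * (t ^ 2 - 1) * aeval (t + t⁻¹) (coxeterTrace d) =
      t ^ (2 * d) * (t ^ 3 - t - 1) + t * (t ^ 3 + t ^ 2 - 1) := by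
  induction d using Nat.twoStepInduction with
  | zero =>
    simp only [coxeterTrace, map_add, aeval_X, map_ofNat]
    field_simp
    ring
  | one =>
    simp only [coxeterTrace, map_add, aeval_X, map_one]
    field_simp
    ring
  | more d ih₀ ih₁ =>
    rw [aeval_coxeterTrace_add_two]
    have hinv := mul_inv_cancel₀ ht
    linear_combination (exp := 1) (t ^ 2 + 1) * ih₁ - t ^ 2 * ih₀ +
      t ^ (d + 2) * (t ^ 2 - 1) * aeval (t + t⁻¹) (coxeterTrace (d + 1)) * hinv

section Trace

variable {K : Type*} [Field K] {t : K} {d : ℕ}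

theorem aeval_salemPoly_eq_zero_of_coxeterTrace_succ (ht : t ≠ 0)
    (h : aeval (t + t⁻¹) (coxeterTrace (d + 1)) = 0) :
    aeval t (salemPoly (-1) (2 * d + 1)) = 0 := by
  have hG := pow_mul_aeval_add_inv_coxeterTrace ht (d + 1)
  rw [h] at hG
  rw [aeval_salemPoly]
  push_cast
  refine (mul_eq_zero.1 (?_ : t * _ = 0)).resolve_left ht
  linear_combination -hG

theorem aeval_salemPoly_eq_zero_of_coxeterTrace_add (ht : t ≠ 0) (ht₁ : t ≠ -1)
    (h : aeval (t + t⁻¹) (coxeterTrace (d + 1) + coxeterTrace d) = 0) :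
    aeval t (salemPoly (-1) (2 * d)) = 0 := by
  have hG := pow_mul_aeval_add_inv_coxeterTrace ht d
  have hG' := pow_mul_aeval_add_inv_coxeterTrace ht (d + 1)
  rw [map_add] at h
  rw [aeval_salemPoly]
  push_cast
  refine (mul_eq_zero.1 (?_ : t * (t + 1) * _ = 0)).resolve_left
    (mul_ne_zero ht (add_eq_zero_iff_eq_neg.not.2 ht₁))
  linear_combination t ^ (d + 2) * (t ^ 2 - 1) * h - hG' - t * hG

theorem aeval_salemPoly_eq_zero_of_coxeterTrace_sub (ht : t ≠ 0) (ht₁ : t ≠ 1)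
    (h : aeval (t + t⁻¹) (coxeterTrace (d + 1) - coxeterTrace d) = 0) :
    aeval t (salemPoly 1 (2 * d)) = 0 := by
  have hG := pow_mul_aeval_add_inv_coxeterTrace ht d
  have hG' := pow_mul_aeval_add_inv_coxeterTrace ht (d + 1)
  rw [map_sub] at h
  rw [aeval_salemPoly]
  push_cast
  refine (mul_eq_zero.1 (?_ : t * (t - 1) * _ = 0)).resolve_left
    (mul_ne_zero ht (sub_ne_zero.2 ht₁))
  linear_combination t ^ (d + 2) * (t ^ 2 - 1) * h - hG' + t * hG

theorem add_inv_eq_neg_one_of_isPrimitiveRoot_three [CharZero K] (ht : IsPrimitiveRoot t 3) :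
    t + t⁻¹ = -1 := by
  have ht₀ := ht.ne_zero (by decide)
  field_simp
  linear_combination isPrimitiveRoot_three_iff.1 ht

theorem add_inv_sq_add_of_isPrimitiveRoot_five [CharZero K] (ht : IsPrimitiveRoot t 5) :
    (t + t⁻¹) ^ 2 + (t + t⁻¹) - 1 = 0 := by
  have ht₀ := ht.ne_zero (by decide)
  field_simp
  linear_combination isPrimitiveRoot_five_iff.1 ht

end Trace

theorem CyclotomicFree.of_sq_ne_one {T : ℤ[X]} (h₂ : aeval (2 : ℤ) T ≠ 0)
    (hneg₂ : aeval (-2 : ℤ) T ≠ 0)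
    (h : ∀ ζ : ℂ, IsOfFinOrder ζ → ζ ^ 2 ≠ 1 → aeval (ζ + ζ⁻¹) T ≠ 0) : CyclotomicFree T := by
  intro ζ hζ
  by_cases hsq : ζ ^ 2 = 1
  · rcases sq_eq_one_iff.1 hsq with rfl | rfl
    · rw [inv_one, show (1 + 1 : ℂ) = algebraMap ℤ ℂ 2 by norm_num]
      exact (aeval_algebraMap_eq_zero_iff ℂ 2 T).not.2 h₂
    · rw [inv_neg_one, show (-1 + -1 : ℂ) = algebraMap ℤ ℂ (-2) by norm_num]
      exact (aeval_algebraMap_eq_zero_iff ℂ (-2) T).not.2 hneg₂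
  · exact h ζ hζ hsq

theorem cyclotomicFree_of_mul_eq_coxeterTrace {f T : ℤ[X]} {d : ℕ} (hd : Odd d)
    (hfT : f * T = coxeterTrace d) (h₃ : ¬d ≡ 1 [MOD 3]) (h₉ : ¬d ≡ 3 [MOD 9])
    (h₅ : d ≡ 4 [MOD 5] → ∀ y : ℂ, y ^ 2 + y - 1 = 0 → aeval y T ≠ 0) : CyclotomicFree T := by
  have hzero {R : Type} [CommRing R] {y : R} (h : aeval y T = 0) :
      aeval y (coxeterTrace d) = 0 := by rw [← hfT, map_mul, h, mul_zero]
  obtain ⟨k, rfl⟩ := hd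
  refine .of_sq_ne_one (fun h => ?_) (fun h => ?_) fun ζ hζ hsq h => ?_
  · have := hzero h
    rw [aeval_two_coxeterTrace] at this
    omega
  · have := hzero h
    rw [aeval_neg_two_coxeterTrace, mul_eq_zero_iff_left (by simp)] at this
    omega
  · have hcases := isPrimitiveRoot_of_aeval_salemPoly_neg_one_of_odd hζ (odd_two_mul_add_one _)
      (aeval_salemPoly_eq_zero_of_coxeterTrace_succ hζ.isUnit.ne_zero (hzero h))
    simp only [Nat.ModEq] at hcases h₃ h₅ h₉
    rcases hcases with h₁ | ⟨-, hm⟩ | ⟨hprim, hm⟩ | hm | hm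
    · exact hsq h₁
    · omega
    · exact h₅ (by omega) _ (add_inv_sq_add_of_isPrimitiveRoot_five hprim) h
    · omega
    · omega

theorem cyclotomicFree_of_mul_eq_coxeterTrace_add {f T : ℤ[X]} {d : ℕ} (hd : Odd d)
    (hfT : f * T = coxeterTrace (d + 1) + coxeterTrace d) (h₁₅ : ¬d ≡ 3 [MOD 15])
    (h₃ : d ≡ 2 [MOD 3] → aeval (-1 : ℤ) T ≠ 0)
    (h₅ : d ≡ 1 [MOD 5] → ∀ y : ℂ, y ^ 2 + y - 1 = 0 → aeval y T ≠ 0) : CyclotomicFree T := by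
  have hzero {R : Type} [CommRing R] {y : R} (h : aeval y T = 0) :
      aeval y (coxeterTrace (d + 1) + coxeterTrace d) = 0 := by rw [← hfT, map_mul, h, mul_zero]
  refine .of_sq_ne_one (fun h => ?_) (fun h => ?_) fun ζ hζ hsq h => ?_
  · have := hzero h
    rw [map_add, aeval_two_coxeterTrace, aeval_two_coxeterTrace] at this
    omega
  · have := hzero h
    rw [map_add, aeval_neg_two_coxeterTrace, aeval_neg_two_coxeterTrace, hd.add_one.neg_one_pow,
      hd.neg_one_pow] at this
    omega
  · have hneg : ζ ≠ -1 := by rintro rfl; simp at hsq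
    have hcases := isPrimitiveRoot_of_aeval_salemPoly_neg_one_of_even hζ (even_two_mul d)
      (aeval_salemPoly_eq_zero_of_coxeterTrace_add hζ.isUnit.ne_zero hneg (hzero h))
    simp only [Nat.ModEq, Nat.odd_iff] at hcases hd h₃ h₅ h₁₅
    rcases hcases with h₁ | ⟨hprim, hm⟩ | ⟨hprim, hm⟩ | hm | hm
    · exact hsq h₁
    · rw [add_inv_eq_neg_one_of_isPrimitiveRoot_three hprim,
        show (-1 : ℂ) = algebraMap ℤ ℂ (-1) by norm_num, aeval_algebraMap_eq_zero_iff] at h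
      exact h₃ (by omega) h
    · exact h₅ (by omega) _ (add_inv_sq_add_of_isPrimitiveRoot_five hprim) h
    · omega
    · omega

theorem cyclotomicFree_coxeterTrace_sub {d : ℕ} (hd : Even d) (h₉ : ¬d ≡ 7 [MOD 9]) :
    CyclotomicFree (coxeterTrace (d + 1) - coxeterTrace d) := by
  refine .of_sq_ne_one ?_ ?_ fun ζ hζ hsq h => ?_
  · rw [map_sub, aeval_two_coxeterTrace, aeval_two_coxeterTrace]
    omega
  · rw [map_sub, aeval_neg_two_coxeterTrace, aeval_neg_two_coxeterTrace, hd.add_one.neg_one_pow,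
      hd.neg_one_pow]
    omega
  · have hone : ζ ≠ 1 := by rintro rfl; simp at hsq
    have hcases := isPrimitiveRoot_of_aeval_salemPoly_one_of_even hζ (even_two_mul d)
      (aeval_salemPoly_eq_zero_of_coxeterTrace_sub hζ.isUnit.ne_zero hone h)
    simp only [Nat.ModEq, Nat.even_iff] at hcases hd h₉
    rcases hcases with h₁ | hm | hm
    · exact hsq h₁
    · omega
    · omega

theorem isUnit_coeff_zero_coxeterTrace {d : ℕ} (hd : Odd d) :
    IsUnit ((coxeterTrace d).coeff 0) := by
  obtain ⟨k, rfl⟩ := hd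
  rw [(coeff_zero_coxeterTrace k).2]
  exact isUnit_neg_one.pow k

theorem isUnit_coeff_zero_coxeterTrace_add {d : ℕ} (hd : Odd d) :
    IsUnit ((coxeterTrace (d + 1) + coxeterTrace d).coeff 0) := by
  obtain ⟨k, rfl⟩ := hd
  rw [coeff_add, show 2 * k + 1 + 1 = 2 * (k + 1) by ring, (coeff_zero_coxeterTrace (k + 1)).1,
    (coeff_zero_coxeterTrace k).2]
  convert (isUnit_neg_one (α := ℤ)).pow (k + 1) using 1
  ring

theorem isUnit_coeff_zero_coxeterTrace_sub {d : ℕ} (hd : Even d) :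
    IsUnit ((coxeterTrace (d + 1) - coxeterTrace d).coeff 0) := by
  obtain ⟨k, rfl⟩ := hd.exists_two_nsmul
  rw [coeff_sub, smul_eq_mul, (coeff_zero_coxeterTrace k).1, (coeff_zero_coxeterTrace k).2]
  convert (isUnit_neg_one (α := ℤ)).pow (k + 1) using 1
  ring

theorem exists_mul_eq_coxeterTrace_add (k : ℕ) :
    ∃ T : ℤ[X], (X + 1) * T = coxeterTrace (3 * k + 2 + 1) + coxeterTrace (3 * k + 2) ∧
      aeval (-1 : ℤ) T ≠ 0 := by
  obtain ⟨h₀, h₁⟩ := aeval_neg_one_coxeterTrace (R := ℤ) k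
  have h₃ := (aeval_neg_one_coxeterTrace (R := ℤ) (k + 1)).1
  obtain ⟨T, hT⟩ : X - C (-1) ∣ coxeterTrace (3 * (k + 1)) + coxeterTrace (3 * k + 2) := by
    rw [dvd_iff_isRoot, IsRoot, ← coe_aeval_eq_eval, map_add, h₃, aeval_coxeterTrace_add_two, h₀,
      h₁]
    ring
  rw [C_neg, C_1, sub_neg_eq_add] at hT
  refine ⟨T, hT.symm, ?_⟩
  obtain ⟨h₀', h₁'⟩ := aeval_neg_one_derivative_coxeterTrace (R := ℤ) k
  have h₃' := (aeval_neg_one_derivative_coxeterTrace (R := ℤ) (k + 1)).1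
  have hderiv := congrArg (fun P => aeval (-1 : ℤ) (derivative P)) hT
  simp only [derivative_mul, map_add, map_mul, derivative_X, derivative_one, map_one, aeval_X,
    zero_mul, one_mul, neg_add_cancel, add_zero, h₃',
    aeval_derivative_coxeterTrace_add_two, h₀', h₁', h₁] at hderiv
  push_cast at hderiv
  omega

/-- The trace polynomial of degree `7` left of `coxeterTrace 9` after removing `X ^ 2 + X - 1`,
whose roots are the traces of the primitive fifth roots of unity. -/
noncomputable def septicTrace : ℤ[X] :=
  X ^ 7 - X ^ 6 - 7 * X ^ 5 + 5 * X ^ 4 + 15 * X ^ 3 - 5 * X ^ 2 - 10 * X - 1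

theorem mul_septicTrace : (X ^ 2 + X - 1) * septicTrace = coxeterTrace 9 := by
  simp only [septicTrace, coxeterTrace]
  ring

theorem aeval_septicTrace_ne_zero {y : ℂ} (hy : y ^ 2 + y - 1 = 0) : aeval y septicTrace ≠ 0 := by
  intro h
  simp only [septicTrace, map_sub, map_add, map_mul, map_pow, aeval_X, map_ofNat, map_one] at h
  have : (19 : ℂ) = 0 := by
    linear_combination -(4 * y + 1) * h +
      ((y ^ 5 - 2 * y ^ 4 - 4 * y ^ 3 + 7 * y ^ 2 + 4 * y - 2) * (4 * y + 1) - 16) * hy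
  norm_num at this

/-- The trace polynomial of degree `9` left of `coxeterTrace 12 + coxeterTrace 11` after removing
the trace polynomials of the primitive third and fifth roots of unity. -/
noncomputable def nonicTrace : ℤ[X] :=
  X ^ 9 - X ^ 8 - 10 * X ^ 7 + 9 * X ^ 6 + 34 * X ^ 5 - 26 * X ^ 4 - 44 * X ^ 3 + 24 * X ^ 2
    + 16 * X - 1

theorem mul_nonicTrace :
    (X + 1) * (X ^ 2 + X - 1) * nonicTrace = coxeterTrace 12 + coxeterTrace 11 := by
  simp only [nonicTrace, coxeterTrace]
  ring

theorem aeval_neg_one_nonicTrace : aeval (-1 : ℤ) nonicTrace = 8 := by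
  simp only [nonicTrace, map_sub, map_add, map_mul, map_pow, aeval_X, map_ofNat, map_one]
  norm_num

theorem aeval_nonicTrace_ne_zero {y : ℂ} (hy : y ^ 2 + y - 1 = 0) : aeval y nonicTrace ≠ 0 := by
  intro h
  simp only [nonicTrace, map_sub, map_add, map_mul, map_pow, aeval_X, map_ofNat, map_one] at h
  have : (29 : ℂ) = 0 := by
    linear_combination (5 * y + 1) * h - ((y ^ 7 - 2 * y ^ 6 - 7 * y ^ 5 + 14 * y ^ 4 + 13 * y ^ 3
      - 25 * y ^ 2 - 6 * y + 5) * (5 * y + 1) + 25) * hy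
  norm_num at this

/-- `IsSalemTrace c T` for `T` of degree `n` with constant term `±1`, so that the roots of `T` are
algebraic units. -/
structure IsUnitSalemTrace (c : ℝ) (n : ℕ) (T : ℤ[X]) : Prop where
  isSalemTrace : IsSalemTrace c T
  isMonicOfDegree : IsMonicOfDegree T n
  isUnit_coeff_zero : IsUnit (T.coeff 0)

theorem IsUnitSalemTrace.of_mul {f T : ℤ[X]} {m n : ℕ} {c : ℝ} (hf : IsMonicOfDegree f m)
    (h : IsUnitSalemTrace c (m + n) (f * T)) : IsUnitSalemTrace c n T where
  isSalemTrace := h.isSalemTrace.of_mul hf.monic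
  isMonicOfDegree := hf.of_mul_left h.isMonicOfDegree
  isUnit_coeff_zero := isUnit_of_mul_isUnit_right (mul_coeff_zero f T ▸ h.isUnit_coeff_zero)

theorem isUnitSalemTrace_coxeterTrace {d : ℕ} (hd : Odd d) :
    IsUnitSalemTrace 2.08 d (coxeterTrace d) := by
  obtain ⟨d, rfl⟩ := Nat.exists_eq_succ_of_ne_zero hd.pos.ne'
  exact ⟨isSalemTrace_coxeterTrace_succ d, isMonicOfDegree_coxeterTrace_succ d,
    isUnit_coeff_zero_coxeterTrace hd⟩

theorem isUnitSalemTrace_coxeterTrace_add {d : ℕ} (hd : Odd d) :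
    IsUnitSalemTrace 2.08 (d + 1) (coxeterTrace (d + 1) + coxeterTrace d) := by
  obtain ⟨d, rfl⟩ := Nat.exists_eq_succ_of_ne_zero hd.pos.ne'
  exact ⟨isSalemTrace_coxeterTrace_succ_add d, isMonicOfDegree_coxeterTrace_succ_add d,
    isUnit_coeff_zero_coxeterTrace_add hd⟩

theorem isUnitSalemTrace_coxeterTrace_sub {d : ℕ} (hd : Even d) (hd12 : 12 ≤ d) :
    IsUnitSalemTrace 2.08 (d + 1) (coxeterTrace (d + 1) - coxeterTrace d) := by
  obtain ⟨d, rfl⟩ := Nat.exists_eq_add_of_le' (show 1 ≤ d by omega)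
  exact ⟨isSalemTrace_coxeterTrace_succ_sub (by omega), isMonicOfDegree_coxeterTrace_succ_sub d,
    isUnit_coeff_zero_coxeterTrace_sub hd⟩

theorem isMonicOfDegree_X_sq_add_X_sub_one : IsMonicOfDegree (X ^ 2 + X - 1 : ℤ[X]) 2 := by
  convert isMonicOfDegree_add_add_two (1 : ℤ) (-1) using 1
  simp only [C_1, one_mul, C_neg, sub_eq_add_neg]

theorem isUnitSalemTrace_septicTrace : IsUnitSalemTrace 2.08 7 septicTrace :=
  .of_mul isMonicOfDegree_X_sq_add_X_sub_one
    (mul_septicTrace ▸ isUnitSalemTrace_coxeterTrace (by decide))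

theorem isUnitSalemTrace_nonicTrace : IsUnitSalemTrace 2.08 9 nonicTrace :=
  .of_mul ((isMonicOfDegree_X_add_one 1).mul isMonicOfDegree_X_sq_add_X_sub_one)
    (mul_nonicTrace ▸ isUnitSalemTrace_coxeterTrace_add (by decide))

theorem exists_isUnitSalemTrace_of_modEq_two {p : ℕ} (hp : Odd p) (h₃ : p ≡ 2 [MOD 3]) :
    ∃ T : ℤ[X], IsUnitSalemTrace 2.08 p T ∧ CyclotomicFree T := by
  simp only [Nat.ModEq] at h₃
  by_cases h₅ : p % 5 = 4
  · obtain ⟨k, rfl⟩ : ∃ k, p = 3 * k + 2 := ⟨p / 3, by omega⟩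
    obtain ⟨T, hT, hneg⟩ := exists_mul_eq_coxeterTrace_add k
    have hsalem := isUnitSalemTrace_coxeterTrace_add hp
    rw [← hT, add_comm _ 1] at hsalem
    exact ⟨T, .of_mul (isMonicOfDegree_X_add_one 1) hsalem,
      cyclotomicFree_of_mul_eq_coxeterTrace_add hp hT (by simp only [Nat.ModEq]; omega)
        (fun _ => hneg) (by simp only [Nat.ModEq]; omega)⟩
  · exact ⟨coxeterTrace p, isUnitSalemTrace_coxeterTrace hp,
      cyclotomicFree_of_mul_eq_coxeterTrace hp (one_mul _) (by simp only [Nat.ModEq]; omega)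
        (by simp only [Nat.ModEq]; omega) (by simp only [Nat.ModEq]; omega)⟩

theorem exists_isUnitSalemTrace_of_odd {p : ℕ} (hp : Odd p) (hp3 : 3 < p) :
    ∃ T : ℤ[X], IsUnitSalemTrace 2.08 p T ∧ CyclotomicFree T := by
  by_cases h₃ : p ≡ 2 [MOD 3]
  · exact exists_isUnitSalemTrace_of_modEq_two hp h₃
  simp only [Nat.ModEq] at h₃
  obtain rfl | rfl | hp13 : p = 7 ∨ p = 9 ∨ 13 ≤ p := by
    rw [Nat.odd_iff] at hp
    omega
  · exact ⟨septicTrace, isUnitSalemTrace_septicTrace,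
      cyclotomicFree_of_mul_eq_coxeterTrace (by decide) mul_septicTrace (by decide) (by decide)
        fun _ _ => aeval_septicTrace_ne_zero⟩
  · exact ⟨nonicTrace, isUnitSalemTrace_nonicTrace,
      cyclotomicFree_of_mul_eq_coxeterTrace_add (d := 11) (by decide) mul_nonicTrace (by decide)
        (fun _ => by rw [aeval_neg_one_nonicTrace]; decide) fun _ _ => aeval_nonicTrace_ne_zero⟩
  · obtain ⟨d, rfl⟩ := Nat.exists_eq_add_of_le' (show 1 ≤ p by omega)
    have hd : Even d := by simpa [parity_simps] using hp
    exact ⟨coxeterTrace (d + 1) - coxeterTrace d, isUnitSalemTrace_coxeterTrace_sub hd (by omega),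
      cyclotomicFree_coxeterTrace_sub hd (by simp only [Nat.ModEq]; omega)⟩

theorem proposition5p9_general (p : ℕ) (hp : Odd p) (hp3 : 3 < p) :
    ∃ T : ℤ[X], T.Monic ∧ Irreducible T ∧ T.natDegree = p ∧ (T.coeff 0 = 1 ∨ T.coeff 0 = -1) ∧
      ∀ z : ℂ, aeval z T = 0 → ∃ r : ℝ, r ∈ Set.Ioo (-2.08 : ℝ) 2.08 ∧ z = (r : ℂ) := by
  obtain ⟨T, ⟨hT, hdeg, hunit⟩, hcyc⟩ := exists_isUnitSalemTrace_of_odd hp hp3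
  refine ⟨T, hdeg.monic, hT.irreducible (by rw [hdeg.natDegree_eq]; omega) hcyc,
    hdeg.natDegree_eq, Int.isUnit_iff.1 hunit, fun z hz => ?_⟩
  obtain ⟨r, hr, rfl⟩ := hT.exists_mem_roots_eq hz
  obtain ⟨hl, hu⟩ := hT.roots_mem r hr
  exact ⟨r, ⟨by linarith, hu⟩, rfl⟩

theorem proposition5p9 (p : ℕ) (hp : p.Prime) (hp3 : 3 < p) :
    ∃ T : Polynomial ℤ,
      T.Monic ∧ Irreducible T ∧ T.natDegree = p ∧
      (T.coeff 0 = 1 ∨ T.coeff 0 = -1) ∧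
      ∀ z : ℂ, Polynomial.aeval z T = 0 →
        ∃ r : ℝ, r ∈ Set.Ioo (-2.08 : ℝ) 2.08 ∧ z = (r : ℂ) :=
  proposition5p9_general p (hp.odd_of_ne_two (by omega)) hp3
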